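/- Let $G$ be a compact connected Lie group with Lie algebra $\mathfrak g=T_eG$ and maximal torus $T_{\max}$. Let $T\subset T_{\max}\times T_{\max}$ be a torus with $\dim T=\operatorname{rk}G$, let $T'\subset T_{\max}\times T_{\max}$ be a complementary torus (i.e. $\mathfrak t\oplus\mathfrak t'=\mathfrak t_{\max}\oplus\mathfrak t_{\max}$), and let $H\subset G\times G$ be a closed connected subgroup with $T\subset H$ and $\operatorname{rk}H=\operatorname{rk}G$ which acts freely on $G$ by $(h_1,h_2)\cdot g=h_1gh_2^{-1}$. Let $\pi\colon G\to G/\!/H$, $g\mapsto Hg$, be the projection to the orbit space, which carries the smooth structure for which $\pi$ is a submersion. Let $\tilde T\subset T'$ be a torus commuting with $H$; it acts on $G/\!/H$ by $(t_1,t_2)\cdot Hg=H(t_1gt_2^{-1})$. Fix a bi-invariant Riemannian metric on $G$, and let $g\in G$ be such that $Hg$ is fixed by $\tilde T$. For $t=(t_1,t_2)\in\tilde T$ let $(s_1,s_2)$ be the unique element of $H$ with $t_1gt_2^{-1}=s_1gs_2^{-1}$, and put $\psi_g(t)=s_2^{-1}t_2$. This defines a continuous homomorphism $\psi_g\colon\tilde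 T\to G$; we write $d\psi_g$ for its differential, as a linear map from $\tilde{\mathfrak t}$ to the Lie algebra of the torus $\operatorname{Im}(\psi_g)$. For a torus $A$ acting linearly on a finite-dimensional real vector space $V$, a weight is a linear functional $\mu\colon\mathfrak a\to\mathbb R$ on the Lie algebra of $A$ for which there is a nonzero $v\in V\otimes\mathbb C$ with $\exp(X)\cdot v=e^{i\mu(X)}v$ for all $X\in\mathfrak a$. (So the set of weights is symmetric under $\mu\mapsto-\mu$, and contains $0$ if $A$ has nonzero fixed vectors in $V$.) Then: 1. $d(t)_{Hg}\circ d\pi_g\circ d(l_g)_e=d\pi_g\circ d(l_g)_e\circ\operatorname{Ad}_{\psi_g(t)}$ on $\mathfrak g$ for all $t\in\tilde T$, where $l_g$ is left translation by $g$. 2. The subspace $W_g=d(l_{g^{-1}})_g\big((\ker d\pi_g)^{\perp}\big)\subset\mathfrak g$ is invariant under $\operatorname{Ad}_a$ for all $a\in\operatorname{Im}(\psi_g)$. 3. Let $\hat\Delta_g$ be the set of weights of the adjoint action of the torus $\operatorname{Im}(\psi_g)$ on $W_g$. The set of weights of the isotropy representation $t\mapsto d(t)_{Hg}$ of $\tilde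 T$ on $T_{Hg}(G/\!/H)$ is $\{\lambda\circ d\psi_g\mid\lambda\in\hat\Delta_g\}$. -/

import Mathlib

open scoped Manifold ContDiff TensorProduct

noncomputable section

namespace BiquotientWeights

/-! ### Tori, ranks and one-parameter subgroups -/

section Tori

variable {K : Type*} [Group K] [TopologicalSpace K]

/-- `S` is a torus of dimension `k`: it is isomorphic, as a topological group, to `(S¹)ᵏ`. -/
def IsTorusOfDim (S : Subgroup K) (k : ℕ) : Prop :=
  Nonempty ((Fin k → Circle) ≃ₜ* S)

/-- `S` is a torus. -/
def IsTorus (S : Subgroup K) : Prop := ∃ k : ℕ, IsTorusOfDim S k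

/-- `S` is a maximal torus of `K`: a torus which is maximal with respect to inclusion. -/
def IsMaximalTorus (S : Subgroup K) : Prop := Maximal (fun S' : Subgroup K => IsTorus S') S

variable (K) in
/-- `K` has rank `r`: it has a maximal torus of dimension `r`. (All maximal tori of a compact
Lie group have the same dimension.) -/
def HasRank (r : ℕ) : Prop := ∃ S : Subgroup K, IsMaximalTorus S ∧ IsTorusOfDim S r

theorem IsTorus.isMulCommutative {S : Subgroup K} (h : IsTorus S) : IsMulCommutative S := by
  obtain ⟨k, ⟨e⟩⟩ := h
  exact ⟨⟨fun a b => e.symm.injective (by rw [map_mul, map_mul, mul_comm])⟩⟩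

end Tori

/-- The one-parameter subgroups of a topological group `A`, i.e. the continuous homomorphisms
`ℝ → A`. If `A` is a Lie group, each of them is smooth, and `γ ↦ γ'(0)` identifies this set with
the Lie algebra of `A`; the exponential map is then `γ ↦ γ(1)`. -/
def OneParam (A : Type*) [Group A] [TopologicalSpace A] : Type _ := Multiplicative ℝ →ₜ* A

namespace OneParam

section Basic

variable {A : Type*} [Group A] [TopologicalSpace A]

/-- The value `γ(s)` of a one-parameter subgroup at time `s`. -/
def at_ (γ : OneParam A) (s : ℝ) : A :=
  (show Multiplicative ℝ →ₜ* A from γ) (Multiplicative.ofAdd s)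

/-- The exponential map `γ ↦ γ(1)`. -/
def exp (γ : OneParam A) : A := γ.at_ 1

@[ext]
theorem ext' {γ δ : OneParam A} (h : ∀ s, γ.at_ s = δ.at_ s) : γ = δ :=
  ContinuousMonoidHom.ext fun x => h (Multiplicative.toAdd x)

/-- Multiplication by `c`, as a continuous endomorphism of the additive group `ℝ`. -/
def scale (c : ℝ) : Multiplicative ℝ →ₜ* Multiplicative ℝ where
  toFun x := Multiplicative.ofAdd (c * Multiplicative.toAdd x)
  map_one' := by simp
  map_mul' x y := by simp [mul_add]
  continuous_toFun :=
    continuous_ofAdd.comp (continuous_const.mul continuous_toAdd)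

instance : SMul ℝ (OneParam A) where
  smul c γ := ContinuousMonoidHom.comp (show Multiplicative ℝ →ₜ* A from γ) (scale c)

theorem smul_at (c : ℝ) (γ : OneParam A) (s : ℝ) : (c • γ).at_ s = γ.at_ (c * s) := rfl

theorem at_add (γ : OneParam A) (s t : ℝ) : γ.at_ (s + t) = γ.at_ s * γ.at_ t :=
  map_mul (show Multiplicative ℝ →ₜ* A from γ) _ _

theorem at_zero (γ : OneParam A) : γ.at_ 0 = 1 :=
  map_one (show Multiplicative ℝ →ₜ* A from γ)

end Basic

section LieAlgebra

open scoped IsMulCommutative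

variable {A : Type*} [Group A] [IsMulCommutative A] [TopologicalSpace A] [IsTopologicalGroup A]
variable {B : Type*} [Group B] [IsMulCommutative B] [TopologicalSpace B] [IsTopologicalGroup B]

/-- The one-parameter subgroups of a commutative group `A` can be added:
`(γ + δ)(s) = γ(s) δ(s)`. -/
instance : AddCommGroup (OneParam A) :=
  inferInstanceAs (AddCommGroup (Additive (Multiplicative ℝ →ₜ* A)))

theorem add_at (γ δ : OneParam A) (s : ℝ) : (γ + δ).at_ s = γ.at_ s * δ.at_ s := rfl

theorem zero_at (s : ℝ) : (0 : OneParam A).at_ s = 1 := rfl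

/-- The Lie algebra of a commutative group `A` (such as a torus) as a real vector space:
`(γ + δ)(s) = γ(s) δ(s)` and `(c γ)(s) = γ(c s)`. -/
instance : Module ℝ (OneParam A) where
  one_smul γ := by ext s; simp [smul_at]
  mul_smul c d γ := by ext s; simp only [smul_at]; congr 1; ring
  smul_zero c := by ext s; simp [smul_at, zero_at]
  smul_add c γ δ := by ext s; simp [smul_at, add_at]
  add_smul c d γ := by ext s; simp [smul_at, add_at, add_mul, at_add]
  zero_smul γ := by ext s; simp [smul_at, zero_at, at_zero]

/-- The differential of a continuous homomorphism `f : A → B`: it maps the one-parameter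
subgroup `γ` to `f ∘ γ`. -/
def differential (f : A →ₜ* B) : OneParam A →ₗ[ℝ] OneParam B where
  toFun γ := f.comp (show Multiplicative ℝ →ₜ* A from γ)
  map_add' γ δ := ext' fun s => map_mul f (γ.at_ s) (δ.at_ s)
  map_smul' _ _ := rfl

theorem differential_at (f : A →ₜ* B) (γ : OneParam A) (s : ℝ) :
    (differential f γ).at_ s = f (γ.at_ s) := rfl

end LieAlgebra

end OneParam

section Weights

open scoped IsMulCommutative

variable {A : Type*} [Group A] [IsMulCommutative A] [TopologicalSpace A] [IsTopologicalGroup A]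
variable {V : Type*} [AddCommGroup V] [Module ℝ V]

/-- The set of (real) weights of the torus `A`, acting by the real linear operators `ρ a`, on the
invariant subspace `W`: those linear functionals `μ` on the Lie algebra of `A` for which there is
a nonzero vector `v` in the complexification of `W` with `ρ(exp γ) v = e^{i μ(γ)} v` for all `γ`
in the Lie algebra of `A`. -/
def weights (ρ : A → (V →ₗ[ℝ] V)) (W : Submodule ℝ V) : Set (Module.Dual ℝ (OneParam A)) :=
  {μ | ∃ v ∈ W.baseChange ℂ, v ≠ 0 ∧ ∀ γ : OneParam A,
    (ρ γ.exp).baseChange ℂ v = Complex.exp ((μ γ : ℂ) * Complex.I) • v}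

end Weights

/-! ### Biquotients -/

/-- The setting: a maximal torus `Tmax` of `G`, a torus `T ⊆ Tmax × Tmax` of dimension
`rk G`, a torus `T' ⊆ Tmax × Tmax` complementary to `T`, a closed connected subgroup
`H ⊆ G × G` with `T ⊆ H` and `rk H = rk G` acting freely on `G` by `(h₁, h₂) · g = h₁ g h₂⁻¹`, and
a torus `Tt ⊆ T'` commuting with `H`. -/
structure Setting (G : Type*) [Group G] [TopologicalSpace G] where
  /-- the rank of `G` -/
  r : ℕ
  Tmax : Subgroup G
  Tmax_maximal : IsMaximalTorus Tmax
  Tmax_dim : IsTorusOfDim Tmax r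
  T : Subgroup (G × G)
  T_le : T ≤ Tmax.prod Tmax
  T_dim : IsTorusOfDim T r
  T' : Subgroup (G × G)
  T'_le : T' ≤ Tmax.prod Tmax
  T'_torus : IsTorus T'
  /-- `𝔱 ⊕ 𝔱' = 𝔱max ⊕ 𝔱max` -/
  complementary : ∀ γ : OneParam (Tmax.prod Tmax), ∃! p : OneParam T × OneParam T',
    ∀ s : ℝ, (γ.at_ s : G × G) = (p.1.at_ s : G × G) * (p.2.at_ s : G × G)
  H : Subgroup (G × G)
  H_closed : IsClosed (H : Set (G × G))
  H_connected : IsConnected (H : Set (G × G))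
  T_le_H : T ≤ H
  H_rank : HasRank H r
  H_free : ∀ h ∈ H, ∀ g : G, h.1 * g * h.2⁻¹ = g → h = 1
  /-- the torus acting on the biquotient -/
  Tt : Subgroup (G × G)
  Tt_torus : IsTorus Tt
  Tt_le : Tt ≤ T'
  Tt_comm : ∀ t ∈ Tt, ∀ h ∈ H, t * h = h * t

namespace Setting

section Construction

variable {G : Type*} [Group G] [TopologicalSpace G] (D : Setting G)

instance : IsMulCommutative D.Tt := D.Tt_torus.isMulCommutative

/-- The orbit equivalence relation of the action `(h₁, h₂) · g = h₁ g h₂⁻¹` of `H` on `G`. -/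
def orbitSetoid : Setoid G where
  r x y := ∃ h ∈ D.H, y = h.1 * x * h.2⁻¹
  iseqv :=
    { refl := fun x => ⟨1, D.H.one_mem, by simp⟩
      symm := by
        rintro x y ⟨h, hh, rfl⟩
        exact ⟨h⁻¹, D.H.inv_mem hh, by simp [mul_assoc]⟩
      trans := by
        rintro x y z ⟨h, hh, rfl⟩ ⟨k, hk, rfl⟩
        exact ⟨k * h, D.H.mul_mem hk hh, by simp [mul_assoc]⟩ }

/-- The biquotient `G // H`, i.e. the space of `H`-orbits in `G`. -/
def Biquotient : Type _ := Quotient D.orbitSetoid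

instance : TopologicalSpace D.Biquotient :=
  inferInstanceAs (TopologicalSpace (Quotient D.orbitSetoid))

/-- The projection `π : G → G // H`, `g ↦ Hg`. -/
def proj (g : G) : D.Biquotient := Quotient.mk D.orbitSetoid g

/-- The action `(t₁, t₂) · Hg = H(t₁ g t₂⁻¹)` of `Tt` on `G // H`. -/
instance : MulAction D.Tt D.Biquotient where
  smul t := Quotient.map (fun g => t.1.1 * g * t.1.2⁻¹) (by
    rintro x y ⟨h, hh, rfl⟩
    refine ⟨h, hh, ?_⟩
    have e := D.Tt_comm t.1 t.2 h hh
    have e₁ : t.1.1 * h.1 = h.1 * t.1.1 := congrArg Prod.fst e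
    have e₂ : t.1.2 * h.2 = h.2 * t.1.2 := congrArg Prod.snd e
    calc t.1.1 * (h.1 * x * h.2⁻¹) * t.1.2⁻¹
        = (t.1.1 * h.1) * x * (t.1.2 * h.2)⁻¹ := by group
      _ = (h.1 * t.1.1) * x * (h.2 * t.1.2)⁻¹ := by rw [e₁, e₂]
      _ = h.1 * (t.1.1 * x * t.1.2⁻¹) * h.2⁻¹ := by group)
  one_smul b := by
    induction b using Quotient.inductionOn with
    | h g => exact congrArg (Quotient.mk D.orbitSetoid) (by simp)
  mul_smul s t b := by
    induction b using Quotient.inductionOn with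
    | h g => exact congrArg (Quotient.mk D.orbitSetoid) (by simp [mul_assoc])

theorem smul_proj (t : D.Tt) (g : G) : t • D.proj g = D.proj (t.1.1 * g * t.1.2⁻¹) := rfl

variable {g : G}

theorem exists_psi (hg : D.proj g ∈ MulAction.fixedPoints D.Tt D.Biquotient) (t : D.Tt) :
    ∃ s : D.H, t.1.1 * g * t.1.2⁻¹ = s.1.1 * g * s.1.2⁻¹ := by
  obtain ⟨s, hs, e⟩ := Quotient.exact (hg t).symm
  exact ⟨⟨s, hs⟩, e⟩

/-- The (unique) element `ψ(t) = (s₁, s₂)` of `H` with `t₁ g t₂⁻¹ = s₁ g s₂⁻¹`, for a fixed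
point `Hg`. -/
def psi (hg : D.proj g ∈ MulAction.fixedPoints D.Tt D.Biquotient) (t : D.Tt) : D.H :=
  Classical.choose (D.exists_psi hg t)

theorem psi_spec (hg : D.proj g ∈ MulAction.fixedPoints D.Tt D.Biquotient) (t : D.Tt) :
    t.1.1 * g * t.1.2⁻¹ = (D.psi hg t).1.1 * g * (D.psi hg t).1.2⁻¹ :=
  Classical.choose_spec (D.exists_psi hg t)

theorem eq_of_act_eq {s s' : D.H} (h : s.1.1 * g * s.1.2⁻¹ = s'.1.1 * g * s'.1.2⁻¹) :
    s = s' := by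
  have e : (s'⁻¹ * s).1 = 1 := by
    refine D.H_free _ (s'⁻¹ * s).2 g ?_
    calc (s'.1.1⁻¹ * s.1.1) * g * (s'.1.2⁻¹ * s.1.2)⁻¹
        = s'.1.1⁻¹ * (s.1.1 * g * s.1.2⁻¹) * s'.1.2 := by group
      _ = s'.1.1⁻¹ * (s'.1.1 * g * s'.1.2⁻¹) * s'.1.2 := by rw [h]
      _ = g := by group
  exact (inv_mul_eq_one.mp (Subtype.ext e : s'⁻¹ * s = 1)).symm

theorem comm_fst (t : D.Tt) (s : D.H) : t.1.1 * s.1.1 = s.1.1 * t.1.1 :=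
  congrArg Prod.fst (D.Tt_comm t.1 t.2 s.1 s.2)

theorem comm_snd (t : D.Tt) (s : D.H) : t.1.2 * s.1.2 = s.1.2 * t.1.2 :=
  congrArg Prod.snd (D.Tt_comm t.1 t.2 s.1 s.2)

theorem psi_mul (hg : D.proj g ∈ MulAction.fixedPoints D.Tt D.Biquotient) (t t' : D.Tt) :
    D.psi hg (t * t') = D.psi hg t' * D.psi hg t := by
  apply D.eq_of_act_eq (g := g)
  rw [← psi_spec]
  have h := D.psi_spec hg t
  have h' := D.psi_spec hg t'
  set s := D.psi hg t
  set s' := D.psi hg t'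
  calc (t.1.1 * t'.1.1) * g * (t.1.2 * t'.1.2)⁻¹
      = t.1.1 * (t'.1.1 * g * t'.1.2⁻¹) * t.1.2⁻¹ := by group
    _ = t.1.1 * (s'.1.1 * g * s'.1.2⁻¹) * t.1.2⁻¹ := by rw [h']
    _ = (t.1.1 * s'.1.1) * g * (t.1.2 * s'.1.2)⁻¹ := by group
    _ = (s'.1.1 * t.1.1) * g * (s'.1.2 * t.1.2)⁻¹ := by rw [D.comm_fst, D.comm_snd]
    _ = s'.1.1 * (t.1.1 * g * t.1.2⁻¹) * s'.1.2⁻¹ := by group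
    _ = s'.1.1 * (s.1.1 * g * s.1.2⁻¹) * s'.1.2⁻¹ := by rw [h]
    _ = (s'.1.1 * s.1.1) * g * (s'.1.2 * s.1.2)⁻¹ := by group

theorem continuous_psi [IsTopologicalGroup G] [CompactSpace G] [T2Space G]
    (hg : D.proj g ∈ MulAction.fixedPoints D.Tt D.Biquotient) : Continuous (D.psi hg) := by
  have : CompactSpace D.H := isCompact_iff_compactSpace.mp D.H_closed.isCompact
  refine continuous_iff_isClosed.mpr fun C hC => ?_
  have hcl : IsClosed {p : D.Tt × D.H |
      p.1.1.1 * g * p.1.1.2⁻¹ = p.2.1.1 * g * p.2.1.2⁻¹ ∧ p.2 ∈ C} :=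
    (isClosed_eq (by fun_prop) (by fun_prop)).inter (hC.preimage continuous_snd)
  have himg := isClosedMap_fst_of_compactSpace _ hcl
  convert himg using 1
  ext t
  simp only [Set.mem_preimage, Set.mem_image, Set.mem_ofPred_eq, Prod.exists, exists_and_right,
    exists_eq_right]
  constructor
  · exact fun h => ⟨_, D.psi_spec hg t, h⟩
  · rintro ⟨s, h, hs⟩
    rwa [D.eq_of_act_eq ((D.psi_spec hg t).symm.trans h)]

/-- The homomorphism `ψ_g : Tt → G`, `(t₁, t₂) ↦ s₂⁻¹ t₂`, where `(s₁, s₂) = ψ(t₁, t₂)`. -/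
def psiG (hg : D.proj g ∈ MulAction.fixedPoints D.Tt D.Biquotient) : D.Tt →* G :=
  MonoidHom.mk' (fun t => (D.psi hg t).1.2⁻¹ * t.1.2) (by
    intro t t'
    have e : (D.psi hg (t * t')).1.2 = (D.psi hg t').1.2 * (D.psi hg t).1.2 := by
      rw [psi_mul]; rfl
    have c : t.1.2 * (D.psi hg t').1.2⁻¹ = (D.psi hg t').1.2⁻¹ * t.1.2 :=
      ((show Commute t.1.2 (D.psi hg t').1.2 from D.comm_snd t _).inv_right).eq
    calc (D.psi hg (t * t')).1.2⁻¹ * (t.1.2 * t'.1.2)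
        = (D.psi hg t).1.2⁻¹ * ((D.psi hg t').1.2⁻¹ * t.1.2) * t'.1.2 := by rw [e]; group
      _ = (D.psi hg t).1.2⁻¹ * (t.1.2 * (D.psi hg t').1.2⁻¹) * t'.1.2 := by rw [c]
      _ = (D.psi hg t).1.2⁻¹ * t.1.2 * ((D.psi hg t').1.2⁻¹ * t'.1.2) := by group)

theorem psiG_apply (hg : D.proj g ∈ MulAction.fixedPoints D.Tt D.Biquotient) (t : D.Tt) :
    D.psiG hg t = (D.psi hg t).1.2⁻¹ * t.1.2 := rfl

/-- `ψ_g` as a continuous homomorphism from `Tt` onto its image `Im(ψ_g) ⊆ G`. -/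
def psiIm [IsTopologicalGroup G] [CompactSpace G] [T2Space G]
    (hg : D.proj g ∈ MulAction.fixedPoints D.Tt D.Biquotient) : D.Tt →ₜ* (D.psiG hg).range where
  toMonoidHom := (D.psiG hg).rangeRestrict
  continuous_toFun := by
    have h := D.continuous_psi hg
    refine Continuous.subtype_mk ?_ _
    change Continuous fun t : D.Tt => (D.psi hg t).1.2⁻¹ * t.1.2
    fun_prop

end Construction

end Setting

/-! ### The representations -/

section Representations

variable {E : Type*} [NormedAddCommGroup E] [NormedSpace ℝ E]
  {G : Type*} [Group G] [TopologicalSpace G] [ChartedSpace E G]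

variable (E) in
/-- The adjoint representation `Ad_a = d(x ↦ a x a⁻¹)_e` of `G` on its Lie algebra `T_e G`. -/
def Ad (a : G) : GroupLieAlgebra 𝓘(ℝ, E) G →ₗ[ℝ] GroupLieAlgebra 𝓘(ℝ, E) G :=
  (mfderiv 𝓘(ℝ, E) 𝓘(ℝ, E) (fun x : G => a * x * a⁻¹) 1 : E →L[ℝ] E).toLinearMap

variable (E) in
/-- The differential `d(l_g)_e : 𝔤 → T_g G` of the left translation `l_g`. -/
def dLeft (g : G) : GroupLieAlgebra 𝓘(ℝ, E) G →ₗ[ℝ] TangentSpace 𝓘(ℝ, E) g :=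
  (mfderiv 𝓘(ℝ, E) 𝓘(ℝ, E) (fun x : G => g * x) 1 : E →L[ℝ] E).toLinearMap

variable (E) in
/-- The differential `d(l_{g⁻¹})_g : T_g G → 𝔤` of the left translation `l_{g⁻¹}`. -/
def dLeftInv (g : G) : TangentSpace 𝓘(ℝ, E) g →ₗ[ℝ] GroupLieAlgebra 𝓘(ℝ, E) G :=
  (mfderiv 𝓘(ℝ, E) 𝓘(ℝ, E) (fun x : G => g⁻¹ * x) g : E →L[ℝ] E).toLinearMap

/-- A Riemannian metric on `G` is bi-invariant if all left and right translations are
isometries. -/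
def IsBiinvariant [IsManifold 𝓘(ℝ, E) ∞ G]
    (m : Bundle.ContMDiffRiemannianMetric 𝓘(ℝ, E) ∞ E
      (fun x : G => TangentSpace 𝓘(ℝ, E) x)) : Prop :=
  (∀ (a x : G) (v w : TangentSpace 𝓘(ℝ, E) x),
    m.inner (a * x) (mfderiv 𝓘(ℝ, E) 𝓘(ℝ, E) (fun y : G => a * y) x v)
      (mfderiv 𝓘(ℝ, E) 𝓘(ℝ, E) (fun y : G => a * y) x w) = m.inner x v w) ∧
  (∀ (a x : G) (v w : TangentSpace 𝓘(ℝ, E) x),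
    m.inner (x * a) (mfderiv 𝓘(ℝ, E) 𝓘(ℝ, E) (fun y : G => y * a) x v)
      (mfderiv 𝓘(ℝ, E) 𝓘(ℝ, E) (fun y : G => y * a) x w) = m.inner x v w)

namespace Setting

variable (D : Setting G)
  {F : Type*} [NormedAddCommGroup F] [NormedSpace ℝ F] [ChartedSpace F D.Biquotient]

variable (E F) in
/-- The differential `dπ_g : T_g G → T_{Hg}(G // H)` of the projection. -/
def dProj (g : G) : TangentSpace 𝓘(ℝ, E) g →ₗ[ℝ] TangentSpace 𝓘(ℝ, F) (D.proj g) :=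
  (mfderiv 𝓘(ℝ, E) 𝓘(ℝ, F) D.proj g : E →L[ℝ] F).toLinearMap

variable (F) in
/-- The isotropy representation of `Tt` on the tangent space at the point `b` of `G // H` (to be
used at fixed points `b`): `t` acts by the differential at `b` of `b' ↦ t · b'`. -/
def isotropy (b : D.Biquotient) (t : D.Tt) :
    TangentSpace 𝓘(ℝ, F) b →ₗ[ℝ] TangentSpace 𝓘(ℝ, F) b :=
  (mfderiv 𝓘(ℝ, F) 𝓘(ℝ, F) (fun b' : D.Biquotient => t • b') b : F →L[ℝ] F).toLinearMap

/-- The orthogonal complement `(ker dπ_g)^⊥ ⊆ T_g G` with respect to the metric `m`. -/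
def horizontal (F : Type*) [NormedAddCommGroup F] [NormedSpace ℝ F] [ChartedSpace F D.Biquotient]
    [IsManifold 𝓘(ℝ, E) ∞ G]
    (m : Bundle.ContMDiffRiemannianMetric 𝓘(ℝ, E) ∞ E (fun x : G => TangentSpace 𝓘(ℝ, E) x))
    (g : G) : Submodule ℝ (TangentSpace 𝓘(ℝ, E) g) where
  carrier := {v | ∀ u : TangentSpace 𝓘(ℝ, E) g, D.dProj E F g u = 0 → m.inner g u v = 0}
  zero_mem' := fun u _ => map_zero (m.inner g u)
  add_mem' := fun {v w} hv hw u hu => by rw [map_add, hv u hu, hw u hu, add_zero]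
  smul_mem' := fun c v hv u hu => by rw [map_smul, hv u hu, smul_zero]

/-- The subspace `d(l_{g⁻¹})_g ((ker dπ_g)^⊥)` of `𝔤`. -/
def complement (F : Type*) [NormedAddCommGroup F] [NormedSpace ℝ F] [ChartedSpace F D.Biquotient]
    [IsManifold 𝓘(ℝ, E) ∞ G]
    (m : Bundle.ContMDiffRiemannianMetric 𝓘(ℝ, E) ∞ E (fun x : G => TangentSpace 𝓘(ℝ, E) x))
    (g : G) : Submodule ℝ (GroupLieAlgebra 𝓘(ℝ, E) G) :=
  (D.horizontal F m g).map (dLeftInv E g)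

end Setting

end Representations

end BiquotientWeights

end

/-!
Write `ψ` for the homomorphism `Setting.psiG` into `G`. The geometric point is the identity
`t · π(gx) = π(g ψ(t) x ψ(t)⁻¹)` (`smul_proj_mul`), valid for all `x : G` when `Hg` is
fixed by the torus: in the coordinates `π ∘ l_g`, it acts by conjugation with `ψ(t)`.
Differentiating it at `x = 1` gives the intertwining relation between the isotropy
representation and `Ad ∘ ψ` (`isotropy_dProj_dLeft`). The chain rule needs `b ↦ t · b` to be
differentiable at `Hg`, which holds because the submersion `π` has differentiable local sections
(`exists_local_section`).

The relation shows that `ker (dπ_g ∘ d(l_g)_e)` is invariant under `Ad_a` for `a` in the image of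
`ψ`. As the metric is bi-invariant, `Ad_a` is an isometry of `𝔤`, and `W_g` is the orthogonal
complement of this kernel, so it is invariant as well (`Ad_mem_complement`). It is also a linear
complement of the kernel, hence `dπ_g ∘ d(l_g)_e` maps it isomorphically and equivariantly onto
the tangent space at `Hg`, and the two representations of the torus have the same weights
(`weights_top_eq_of_isCompl`).

It remains to compare the weights of the torus with those of its image `Im ψ`
(`weights_comp_surjective`). Pulling back a weight of the image is immediate. Conversely, on a
weight vector of the torus the image acts by a character, continuous since the torus is compact
(`exists_character`); continuous homomorphisms `ℝ → S¹` are exponentials, so this character has a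
differential (`exists_dual_of_character`), which is the required weight of the image. No
one-parameter subgroup of the image has to be lifted to the torus.
-/

noncomputable section

namespace BiquotientWeights

/-! ### One-parameter subgroups of the circle -/

theorem eq_of_circleExp_mul_eq {a b : ℝ}
    (h : ∀ s : ℝ, Circle.exp (s * a) = Circle.exp (s * b)) : a = b := by
  have key : ∀ s : ℝ, ∃ n : ℤ, s * a = s * b + n * (2 * Real.pi) := fun s =>
    Circle.exp_eq_exp.mp (h s)
  by_contra hab
  have hne : a - b ≠ 0 := sub_ne_zero.mpr hab
  -- at the time where the phases differ by `π`, they do not differ by a multiple of `2π`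
  obtain ⟨n, hn⟩ := key (Real.pi / (a - b))
  have h1 : Real.pi = n * (2 * Real.pi) := by
    have : Real.pi / (a - b) * (a - b) = Real.pi := div_mul_cancel₀ _ hne
    linarith
  have h2 : (1 : ℝ) = 2 * n := by
    have := Real.pi_pos
    nlinarith
  have h3 : (1 : ℤ) = 2 * n := by exact_mod_cast h2
  omega

/-- Every continuous homomorphism `ℝ → S¹` has the form `s ↦ e^{ics}`: its lift through the
covering `ℝ → S¹` vanishing at `0` is additive, hence linear. -/
theorem exists_eq_circleExp_mul (f : ℝ → Circle) (hf : Continuous f)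
    (hadd : ∀ s t, f (s + t) = f s * f t) : ∃ c : ℝ, ∀ s, f s = Circle.exp (s * c) := by
  have h0 : f 0 = 1 := by
    have := hadd 0 0
    simpa using this
  obtain ⟨F, ⟨hF0, hF⟩, -⟩ := Circle.isCoveringMap_exp.existsUnique_continuousMap_lifts
    (⟨f, hf⟩ : C(ℝ, Circle)) 0 0 (by simp [h0])
  have hFe : ∀ s, Circle.exp (F s) = f s := fun s => congrFun hF s
  have hFadd : ∀ s t, F (s + t) = F s + F t := by
    intro s t
    -- both sides lift `s ↦ f (s + t)` and agree at `s = 0`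
    have := Circle.isCoveringMap_exp.eq_of_comp_eq (g₁ := fun s => F (s + t))
      (g₂ := fun s => F s + F t) (by fun_prop) (by fun_prop)
      (by ext s; simp [Circle.exp_add, hFe, hadd]) 0 (by simp [hF0])
    exact congrFun this s
  let A : ℝ →+ ℝ := ⟨⟨F, hF0⟩, hFadd⟩
  let B : ℝ →L[ℝ] ℝ := A.toRealLinearMap F.continuous
  refine ⟨F 1, fun s => ?_⟩
  have : F s = s * F 1 := by
    have := B.map_smul s 1
    simpa [B, A] using this
  rw [← this, hFe]

/-! ### Weights of tori under surjections and equivariant maps -/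

section Character

section General

variable {A : Type*} [Group A] [TopologicalSpace A]

theorem OneParam.exp_smul (s : ℝ) (γ : OneParam A) : (s • γ).exp = γ.at_ s := by
  rw [OneParam.exp, OneParam.smul_at, mul_one]

theorem OneParam.continuous_at (γ : OneParam A) : Continuous γ.at_ :=
  (ContinuousMonoidHom.continuous_toFun (show Multiplicative ℝ →ₜ* A from γ)).comp
    continuous_ofAdd

end General

open scoped IsMulCommutative

variable {A : Type*} [Group A] [IsMulCommutative A] [TopologicalSpace A] [IsTopologicalGroup A]
variable {B : Type*} [Group B] [IsMulCommutative B] [TopologicalSpace B] [IsTopologicalGroup B]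
variable {V : Type*} [AddCommGroup V] [Module ℝ V]

/-- The differential of a character `χ : B → S¹`, as a linear functional `l` on the Lie algebra
of `B`, normalised by `χ (exp γ) = e^{i l(γ)}`. -/
theorem exists_dual_of_character (χ : B →ₜ* Circle) :
    ∃ l : Module.Dual ℝ (OneParam B), ∀ γ s, χ (γ.at_ s) = Circle.exp (s * l γ) := by
  choose l hl using fun γ : OneParam B => exists_eq_circleExp_mul (fun s => χ (γ.at_ s))
    (χ.continuous_toFun.comp γ.continuous_at) (fun s t => by rw [γ.at_add, map_mul])
  refine ⟨{ toFun := l, map_add' := fun γ δ => ?_, map_smul' := fun c γ => ?_ }, hl⟩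
  · refine eq_of_circleExp_mul_eq fun s => ?_
    rw [← hl, mul_add, Circle.exp_add, ← hl, ← hl, OneParam.add_at, map_mul]
  · refine eq_of_circleExp_mul_eq fun s => ?_
    rw [← hl, OneParam.smul_at, hl, RingHom.id_apply, smul_eq_mul]
    congr 1
    ring

/-- In the coordinates of a torus `e : (S¹)ᵏ ≃ A`, the one-parameter subgroup
`s ↦ (e^{i s x₁}, …, e^{i s xₖ})` with velocity `x`. -/
def torusOneParam {A : Type*} [Group A] [TopologicalSpace A] {k : ℕ} (e : (Fin k → Circle) ≃ₜ* A)
    (x : Fin k → ℝ) : OneParam A :=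
  show Multiplicative ℝ →ₜ* A from
  { toFun := fun s => e fun i => Circle.exp (s.toAdd * x i)
    map_one' := by
      rw [← map_one e]
      refine congrArg e (funext fun i => ?_)
      simp
    map_mul' := fun s t => by
      rw [← map_mul e]
      refine congrArg e (funext fun i => ?_)
      simp [add_mul, Circle.exp_add]
    continuous_toFun := e.continuous_toFun.comp <| continuous_pi fun i =>
      Circle.exp.continuous.comp (continuous_toAdd.mul continuous_const) }

theorem torusOneParam_at {A : Type*} [Group A] [TopologicalSpace A] {k : ℕ}
    (e : (Fin k → Circle) ≃ₜ* A) (x : Fin k → ℝ) (s : ℝ) :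
    (torusOneParam e x).at_ s = e fun i => Circle.exp (s * x i) := rfl

/-- In a torus, the exponential map is surjective already on a compact set of one-parameter
subgroups: in coordinates `A ≃ (S¹)ᵏ` it is `(xᵢ) ↦ (e^{i xᵢ})` on the cube `[-π, π]ᵏ`. -/
theorem exists_linear_surjOn_exp {k : ℕ} (e : (Fin k → Circle) ≃ₜ* A) :
    ∃ P : (Fin k → ℝ) →ₗ[ℝ] OneParam A, Continuous (fun x => (P x).exp) ∧
      ∀ a : A, ∃ x ∈ Set.univ.pi fun _ : Fin k => Set.Icc (-Real.pi) Real.pi, (P x).exp = a := by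
  let P : (Fin k → ℝ) →ₗ[ℝ] OneParam A :=
    { toFun := torusOneParam e
      map_add' := fun x y => OneParam.ext' fun s => by
        rw [OneParam.add_at]
        simp only [torusOneParam_at]
        rw [← map_mul e]
        refine congrArg e (funext fun i => ?_)
        simp [mul_add, Circle.exp_add]
      map_smul' := fun c x => OneParam.ext' fun s => by
        rw [RingHom.id_apply, OneParam.smul_at, torusOneParam_at, torusOneParam_at]
        refine congrArg e (funext fun i => ?_)
        rw [Pi.smul_apply, smul_eq_mul, ← mul_assoc, mul_comm c s] }
  have hP : ∀ x, (P x).exp = e fun i => Circle.exp (x i) := fun x => by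
    change (torusOneParam e x).at_ 1 = _
    simp only [torusOneParam_at, one_mul]
  refine ⟨P, ?_, fun a => ?_⟩
  · simp only [hP]
    exact e.continuous_toFun.comp (by fun_prop)
  · refine ⟨fun i => Complex.arg (e.symm a i), fun i _ => ?_, ?_⟩
    · exact ⟨(Complex.neg_pi_lt_arg _).le, Complex.arg_le_pi _⟩
    · rw [hP]
      simp only [Circle.exp_arg]
      exact e.apply_symm_apply a

/-- If a vector `v ≠ 0` is a weight vector for a torus `A` acting through a surjection
`f : A → B`, then `B` acts on `v` by a continuous character. Continuity holds because the graph of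
this character is compact. -/
theorem exists_character {B : Type*} [Group B] [TopologicalSpace B] [T2Space B]
    {k : ℕ} (e : (Fin k → Circle) ≃ₜ* A) (f : A →ₜ* B)
    (hf : Function.Surjective f) (ρ : B →* (V →ₗ[ℝ] V)) {v : ℂ ⊗[ℝ] V} (hv : v ≠ 0)
    {μ : Module.Dual ℝ (OneParam A)}
    (hμ : ∀ γ : OneParam A,
      (ρ (f γ.exp)).baseChange ℂ v = Complex.exp ((μ γ : ℂ) * Complex.I) • v) :
    ∃ χ : B →ₜ* Circle, ∀ b, (ρ b).baseChange ℂ v = (χ b : ℂ) • v := by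
  obtain ⟨P, hPc, hPs⟩ := exists_linear_surjOn_exp e
  set Q : Set (Fin k → ℝ) := Set.univ.pi fun _ : Fin k => Set.Icc (-Real.pi) Real.pi
  have hQ : IsCompact Q := isCompact_univ_pi fun _ => isCompact_Icc
  choose! x hxQ hx using fun b => (hf b).elim fun a ha => (hPs a).elim fun y hy =>
    (⟨y, hy.1, by rw [hy.2, ha]⟩ : ∃ y ∈ Q, f (P y).exp = b)
  let c : (Fin k → ℝ) → Circle := fun y => Circle.exp (μ (P y))
  have hc : Continuous c :=
    Circle.exp.continuous.comp (LinearMap.continuous_of_finiteDimensional (μ ∘ₗ P))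
  have hcv : ∀ y, (ρ (f (P y).exp)).baseChange ℂ v = (c y : ℂ) • v := fun y => hμ (P y)
  have hχ : ∀ b, (ρ b).baseChange ℂ v = (c (x b) : ℂ) • v := fun b => by rw [← hcv, hx]
  have huniq : ∀ {z w : Circle}, (z : ℂ) • v = (w : ℂ) • v → z = w := fun h =>
    Circle.ext (smul_left_injective ℂ hv h)
  have hmul : ∀ a b, c (x (a * b)) = c (x a) * c (x b) := fun a b => huniq <| by
    rw [← hχ, map_mul, LinearMap.baseChange_mul, Module.End.mul_apply, hχ, map_smul, hχ,
      Circle.coe_mul, smul_smul, mul_comm]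
  refine ⟨{ toMonoidHom := MonoidHom.mk' (fun b => c (x b)) hmul, continuous_toFun := ?_ }, hχ⟩
  refine continuous_iff_isClosed.mpr fun C hC => ?_
  have himg : IsClosed ((fun y => f (P y).exp) '' (Q ∩ c ⁻¹' C)) :=
    ((hQ.inter_right (hC.preimage hc)).image (f.continuous_toFun.comp hPc)).isClosed
  convert himg using 1
  ext b
  constructor
  · exact fun hb => ⟨x b, ⟨hxQ b, hb⟩, hx b⟩
  · rintro ⟨y, ⟨-, hy⟩, rfl⟩
    have : c (x (f (P y).exp)) = c y := huniq (by rw [← hχ, hcv])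
    change c (x (f (P y).exp)) ∈ C
    rwa [this]

/-- The weights of a torus `A` acting through a surjection `f : A → B` are the pullbacks of the
weights of `B`. -/
theorem weights_comp_surjective [T2Space B] {k : ℕ} (e : (Fin k → Circle) ≃ₜ* A)
    (f : A →ₜ* B) (hf : Function.Surjective f) (ρ : B →* (V →ₗ[ℝ] V)) (W : Submodule ℝ V) :
    weights (fun a => ρ (f a)) W =
      {μ | ∃ l ∈ weights (fun b => ρ b) W, μ = l ∘ₗ OneParam.differential f} := by
  ext μ
  constructor
  · rintro ⟨v, hvW, hv, hμ⟩
    obtain ⟨χ, hχ⟩ := exists_character e f hf ρ hv hμ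
    obtain ⟨l, hl⟩ := exists_dual_of_character χ
    refine ⟨l, ⟨v, hvW, hv, fun γ => ?_⟩, LinearMap.ext fun γ => eq_of_circleExp_mul_eq fun s => ?_⟩
    · rw [hχ, OneParam.exp, hl, one_mul, Circle.coe_exp]
    · rw [LinearMap.comp_apply, ← hl, OneParam.differential_at]
      refine Circle.ext (smul_left_injective ℂ hv ?_)
      change (_ : ℂ) • v = (_ : ℂ) • v
      rw [← hχ, ← OneParam.exp_smul, hμ, map_smul, smul_eq_mul, Circle.coe_exp]
  · rintro ⟨l, ⟨v, hvW, hv, hl⟩, rfl⟩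
    exact ⟨v, hvW, hv, fun γ => hl (OneParam.differential f γ)⟩

/-- An equivariant surjection `φ : V → U` restricts to an isomorphism from any complement `W` of
its kernel onto `U`; if `W` is invariant, the weights on `W` are therefore those on `U`. -/
theorem weights_top_eq_of_isCompl {U : Type*} [AddCommGroup U] [Module ℝ U]
    (ρ : A → (V →ₗ[ℝ] V)) (ρ' : A → (U →ₗ[ℝ] U)) (φ : V →ₗ[ℝ] U) (hφ : Function.Surjective φ)
    (hρ : ∀ a X, ρ' a (φ X) = φ (ρ a X)) (W : Submodule ℝ V) (hW : IsCompl W (LinearMap.ker φ))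
    (hinv : ∀ a, ∀ X ∈ W, ρ a X ∈ W) :
    weights ρ' ⊤ = weights ρ W := by
  let ε : W ≃ₗ[ℝ] U := LinearEquiv.ofBijective (φ ∘ₗ W.subtype) (by
    constructor
    · rw [← LinearMap.ker_eq_bot, LinearMap.ker_comp, Submodule.eq_bot_iff]
      intro w hw
      exact Subtype.ext (Submodule.disjoint_def.mp hW.disjoint w.1 w.2 hw)
    · intro u
      obtain ⟨X, rfl⟩ := hφ u
      obtain ⟨w, hw, y, hy, rfl⟩ := Submodule.mem_sup.mp
        (hW.codisjoint.eq_top ▸ Submodule.mem_top : X ∈ W ⊔ LinearMap.ker φ)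
      exact ⟨⟨w, hw⟩, by simp [LinearMap.mem_ker.mp hy]⟩)
  let σ : U →ₗ[ℝ] V := W.subtype ∘ₗ ε.symm.toLinearMap
  have hσW : ∀ u, σ u ∈ W := fun u => (ε.symm u).2
  have hφσ : φ ∘ₗ σ = LinearMap.id := LinearMap.ext fun u => ε.apply_symm_apply u
  have hσφ : (σ ∘ₗ φ) ∘ₗ W.subtype = W.subtype := LinearMap.ext fun w =>
    congrArg Subtype.val (ε.symm_apply_apply w)
  have hσ : ∀ a, σ ∘ₗ ρ' a = ρ a ∘ₗ σ := fun a => LinearMap.ext fun u => by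
    have h1 : ρ' a u = φ (ρ a (σ u)) := by
      rw [← hρ]; exact congrArg (ρ' a) (LinearMap.congr_fun hφσ u).symm
    have h2 := LinearMap.congr_fun hσφ ⟨_, hinv a _ (hσW u)⟩
    change σ (ρ' a u) = ρ a (σ u)
    rw [h1]
    exact h2
  have hφσ' : ∀ u, φ.baseChange ℂ (σ.baseChange ℂ u) = u := fun u => by
    rw [← LinearMap.comp_apply, ← LinearMap.baseChange_comp, hφσ, LinearMap.baseChange_id]
    rfl
  have hσφ' : ∀ v ∈ W.baseChange ℂ, σ.baseChange ℂ (φ.baseChange ℂ v) = v := by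
    rintro _ ⟨v, rfl⟩
    have h1 := LinearMap.congr_fun (congrArg (LinearMap.baseChange ℂ) hσφ) v
    rwa [LinearMap.baseChange_comp, LinearMap.baseChange_comp] at h1
  have hmem : ∀ u, σ.baseChange ℂ u ∈ W.baseChange ℂ := fun u => by
    refine ⟨ε.symm.toLinearMap.baseChange ℂ u, ?_⟩
    rw [← LinearMap.comp_apply, ← LinearMap.baseChange_comp]
  have hρ'' : ∀ a v, (ρ' a).baseChange ℂ (φ.baseChange ℂ v) =
      φ.baseChange ℂ ((ρ a).baseChange ℂ v) := fun a v => by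
    rw [← LinearMap.comp_apply, ← LinearMap.baseChange_comp, ← LinearMap.comp_apply,
      ← LinearMap.baseChange_comp]
    exact LinearMap.congr_fun (congrArg _ (LinearMap.ext (hρ a))) v
  have hσ'' : ∀ a u, σ.baseChange ℂ ((ρ' a).baseChange ℂ u) =
      (ρ a).baseChange ℂ (σ.baseChange ℂ u) := fun a u => by
    rw [← LinearMap.comp_apply, ← LinearMap.baseChange_comp, ← LinearMap.comp_apply,
      ← LinearMap.baseChange_comp, hσ]
  ext μ
  constructor
  · rintro ⟨u, -, hu, hμ⟩
    refine ⟨σ.baseChange ℂ u, hmem u, fun h => hu ?_, fun γ => ?_⟩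
    · rw [← hφσ' u, h, map_zero]
    · rw [← hσ'', hμ, map_smul]
  · rintro ⟨v, hvW, hv, hμ⟩
    refine ⟨φ.baseChange ℂ v, by simp, fun h => hv ?_, fun γ => ?_⟩
    · rw [← hσφ' v hvW, h, map_zero]
    · rw [hρ'', hμ, map_smul]

end Character

/-! ### Local sections of submersions -/

section Submersion

open Manifold Topology

variable {E F : Type*} [NormedAddCommGroup E] [NormedSpace ℝ E]
  [NormedAddCommGroup F] [NormedSpace ℝ F]
  {M N : Type*} [TopologicalSpace M] [ChartedSpace E M] [TopologicalSpace N] [ChartedSpace F N]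

/-- A submersion has a differentiable local section through every point: in adapted charts it is
the projection `(u, v) ↦ u`, and `u ↦ (u, v₀)` is a section. -/
theorem exists_local_section {f : M → N} {x : M}
    (hf : IsSubmersionAt 𝓘(ℝ, E) 𝓘(ℝ, F) ∞ f x) :
    ∃ σ : N → M, MDifferentiableAt 𝓘(ℝ, F) 𝓘(ℝ, E) σ (f x) ∧ σ (f x) = x ∧
      ∀ᶠ y in 𝓝 (f x), f (σ y) = y := by
  let φ := hf.domChart
  let χ := hf.codChart
  have hxφ : x ∈ φ.source := hf.mem_domChart_source
  have hxχ : f x ∈ χ.source := hf.mem_codChart_source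
  let L : F → E := fun u => hf.equiv.symm (u, (hf.equiv (φ x)).2)
  have hw : ∀ p ∈ φ.target, χ (f (φ.symm p)) = (hf.equiv p).1 := fun p hp => by
    have hp' : p ∈ (hf.domChart.extend 𝓘(ℝ, E)).target := by simpa using hp
    simpa using hf.writtenInCharts hp'
  have hLx : L (χ (f x)) = φ x := by
    have h := hw (φ x) (φ.map_source hxφ)
    rw [φ.left_inv hxφ] at h
    simp only [L]
    rw [h, Prod.mk.eta, ContinuousLinearEquiv.symm_apply_apply]
  have hL : ContDiff ℝ ∞ L := by fun_prop
  have hφ : ContMDiffAt 𝓘(ℝ, E) 𝓘(ℝ, E) ∞ φ.symm (L (χ (f x))) := by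
    rw [hLx]
    exact contMDiffAt_symm_of_mem_maximalAtlas hf.domChart_mem_maximalAtlas (φ.map_source hxφ)
  have hχ : ContMDiffAt 𝓘(ℝ, F) 𝓘(ℝ, F) ∞ χ (f x) :=
    contMDiffAt_of_mem_maximalAtlas hf.codChart_mem_maximalAtlas hxχ
  have hLχ : ContMDiffAt 𝓘(ℝ, F) 𝓘(ℝ, E) ∞ (fun y => L (χ y)) (f x) :=
    hL.contMDiff.contMDiffAt.comp (f x) hχ
  refine ⟨fun y => φ.symm (L (χ y)), ?_, ?_, ?_⟩
  · exact (hφ.comp (f x) hLχ).mdifferentiableAt (by simp)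
  · simp only [hLx]
    exact φ.left_inv hxφ
  · have h1 : ∀ᶠ y in 𝓝 (f x), L (χ y) ∈ φ.target :=
      hLχ.continuousAt.eventually_mem (by
        rw [hLx]; exact φ.open_target.mem_nhds (φ.map_source hxφ))
    filter_upwards [h1, χ.open_source.mem_nhds hxχ] with y hy hyχ
    have hmem : f (φ.symm (L (χ y))) ∈ χ.source :=
      hf.source_subset_preimage_source (φ.map_target hy)
    refine χ.injOn hmem hyχ ?_
    rw [hw _ hy]
    simp [L]

theorem mfderiv_surjective_of_isSubmersionAt {f : M → N} {x : M}
    (hf : IsSubmersionAt 𝓘(ℝ, E) 𝓘(ℝ, F) ∞ f x) :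
    Function.Surjective (mfderiv 𝓘(ℝ, E) 𝓘(ℝ, F) f x : E → F) := by
  obtain ⟨σ, hσ, hσx, hfσ⟩ := exists_local_section hf
  have hfd : MDifferentiableAt 𝓘(ℝ, E) 𝓘(ℝ, F) f (σ (f x)) := by
    rw [hσx]; exact hf.contMDiffAt.mdifferentiableAt (by simp)
  have h1 := hfd.hasMFDerivAt.comp (f x) hσ.hasMFDerivAt
  have h2 := (hasMFDerivAt_id (I := 𝓘(ℝ, F)) (f x)).congr_of_eventuallyEq
    (f₁ := f ∘ σ) hfσ
  have h3 := hasMFDerivAt_unique h1 h2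
  rw [hσx] at h3
  exact fun u => ⟨_, DFunLike.congr_fun h3 u⟩

/-- Differentiability descends along submersions. -/
theorem mdifferentiableAt_of_comp_submersion {E' : Type*} [NormedAddCommGroup E']
    [NormedSpace ℝ E'] {P : Type*} [TopologicalSpace P] [ChartedSpace E' P] {f : M → N} {x : M}
    (hf : IsSubmersionAt 𝓘(ℝ, E) 𝓘(ℝ, F) ∞ f x) {k : N → P}
    (hk : MDifferentiableAt 𝓘(ℝ, E) 𝓘(ℝ, E') (fun y => k (f y)) x) :
    MDifferentiableAt 𝓘(ℝ, F) 𝓘(ℝ, E') k (f x) := by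
  obtain ⟨σ, hσ, hσx, hfσ⟩ := exists_local_section hf
  rw [← hσx] at hk
  exact (hk.comp (f x) hσ).congr_of_eventuallyEq (hfσ.mono fun y hy => congrArg k hy.symm)

end Submersion

/-! ### Translations, the adjoint representation and bi-invariant metrics -/

section Translations

variable {E : Type*} [NormedAddCommGroup E] [NormedSpace ℝ E]
  {G : Type*} [Group G] [TopologicalSpace G] [ChartedSpace E G] [LieGroup 𝓘(ℝ, E) ∞ G]

theorem mdifferentiable_mul_left (a : G) :
    MDifferentiable 𝓘(ℝ, E) 𝓘(ℝ, E) (fun x : G => a * x) :=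
  (contMDiff_mul_left (I := 𝓘(ℝ, E)) (n := ∞)).mdifferentiable (by simp)

theorem mdifferentiable_mul_right (a : G) :
    MDifferentiable 𝓘(ℝ, E) 𝓘(ℝ, E) (fun x : G => x * a) :=
  (contMDiff_mul_right (I := 𝓘(ℝ, E)) (n := ∞)).mdifferentiable (by simp)

theorem mdifferentiable_mul_mul (a b : G) :
    MDifferentiable 𝓘(ℝ, E) 𝓘(ℝ, E) (fun x : G => a * x * b) :=
  (mdifferentiable_mul_right b).comp (mdifferentiable_mul_left a)

/-- The chain rule for maps between manifolds modelled on vector spaces, with all tangent spaces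
identified with the model space. The value `f x = y` is a hypothesis, to allow for values which
are only propositionally equal to the base point of the second derivative. -/
theorem mfderiv_comp_apply_of_eq {E₁ E₂ E₃ : Type*} [NormedAddCommGroup E₁] [NormedSpace ℝ E₁]
    [NormedAddCommGroup E₂] [NormedSpace ℝ E₂] [NormedAddCommGroup E₃] [NormedSpace ℝ E₃]
    {M₁ M₂ M₃ : Type*} [TopologicalSpace M₁] [ChartedSpace E₁ M₁] [TopologicalSpace M₂]
    [ChartedSpace E₂ M₂] [TopologicalSpace M₃] [ChartedSpace E₃ M₃] {k : M₂ → M₃} {f : M₁ → M₂}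
    {x : M₁} {y : M₂} (hy : f x = y) (hk : MDifferentiableAt 𝓘(ℝ, E₂) 𝓘(ℝ, E₃) k y)
    (hf : MDifferentiableAt 𝓘(ℝ, E₁) 𝓘(ℝ, E₂) f x) (X : E₁) :
    (mfderiv 𝓘(ℝ, E₁) 𝓘(ℝ, E₃) (fun z => k (f z)) x : E₁ →L[ℝ] E₃) X =
      (mfderiv 𝓘(ℝ, E₂) 𝓘(ℝ, E₃) k y : E₂ →L[ℝ] E₃)
        ((mfderiv 𝓘(ℝ, E₁) 𝓘(ℝ, E₂) f x : E₁ →L[ℝ] E₂) X) := by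
  subst hy
  exact DFunLike.congr_fun (mfderiv_comp x hk hf) X

theorem mfderiv_apply_of_eq_id {M : Type*} [TopologicalSpace M] [ChartedSpace E M] {f : M → M}
    (hf : f = id) (x : M) (X : E) :
    (mfderiv 𝓘(ℝ, E) 𝓘(ℝ, E) f x : E →L[ℝ] E) X = X := by
  subst hf
  exact DFunLike.congr_fun (mfderiv_id (I := 𝓘(ℝ, E)) (x := x)) X

omit [LieGroup 𝓘(ℝ, E) ∞ G] in
theorem Ad_one : Ad E (1 : G) = LinearMap.id :=
  LinearMap.ext fun X => mfderiv_apply_of_eq_id (E := E) (by ext x; simp) (1 : G) X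

theorem Ad_mul (a b : G) : Ad E (a * b) = Ad E a ∘ₗ Ad E b := by
  have h : (fun x : G => a * b * x * (a * b)⁻¹) = fun x => a * (b * x * b⁻¹) * a⁻¹ := by
    ext x; group
  refine LinearMap.ext fun X => ?_
  change (mfderiv 𝓘(ℝ, E) 𝓘(ℝ, E) (fun x : G => a * b * x * (a * b)⁻¹) 1 : E →L[ℝ] E) X = _
  rw [h]
  exact mfderiv_comp_apply_of_eq (E₁ := E) (k := fun y : G => a * y * a⁻¹)
    (f := fun x : G => b * x * b⁻¹)
    (by simp) (mdifferentiable_mul_mul _ _ _) (mdifferentiable_mul_mul _ _ _) X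

variable (E) in
/-- The adjoint representation as a homomorphism to the monoid of linear endomorphisms. -/
def AdHom : G →* (GroupLieAlgebra 𝓘(ℝ, E) G →ₗ[ℝ] GroupLieAlgebra 𝓘(ℝ, E) G) where
  toFun := Ad E
  map_one' := Ad_one
  map_mul' := Ad_mul

theorem Ad_inv_apply (a : G) (X : GroupLieAlgebra 𝓘(ℝ, E) G) : Ad E a (Ad E a⁻¹ X) = X := by
  rw [← LinearMap.comp_apply, ← Ad_mul, mul_inv_cancel, Ad_one, LinearMap.id_apply]

theorem dLeft_dLeftInv (g : G) (v : TangentSpace 𝓘(ℝ, E) g) :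
    dLeft E g (dLeftInv E g v) = v := by
  have h := mfderiv_comp_apply_of_eq (E₁ := E) (E₂ := E) (E₃ := E)
    (k := fun y : G => g * y) (f := fun x : G => g⁻¹ * x) (x := g)
    (inv_mul_cancel g) (mdifferentiable_mul_left g (1 : G)) (mdifferentiable_mul_left g⁻¹ g) v
  exact h.symm.trans (mfderiv_apply_of_eq_id (E := E) (by ext x; simp) g v)

theorem dLeftInv_dLeft (g : G) (X : GroupLieAlgebra 𝓘(ℝ, E) G) :
    dLeftInv E g (dLeft E g X) = X := by
  have h := mfderiv_comp_apply_of_eq (E₁ := E) (E₂ := E) (E₃ := E)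
    (k := fun y : G => g⁻¹ * y) (f := fun x : G => g * x) (x := 1)
    (mul_one g) (mdifferentiable_mul_left g⁻¹ g) (mdifferentiable_mul_left g (1 : G)) X
  exact h.symm.trans (mfderiv_apply_of_eq_id (E := E) (by ext x; simp) (1 : G) X)

section Metric

variable {m : Bundle.ContMDiffRiemannianMetric 𝓘(ℝ, E) ∞ E
  (fun x : G => TangentSpace 𝓘(ℝ, E) x)}

/-- The metric at equal points, as a function on the model space. -/
theorem metric_congr {x y : G} (h : x = y) (v w : E) :
    m.inner x (v : TangentSpace 𝓘(ℝ, E) x) (w : TangentSpace 𝓘(ℝ, E) x) =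
      m.inner y (v : TangentSpace 𝓘(ℝ, E) y) (w : TangentSpace 𝓘(ℝ, E) y) := by
  subst h; rfl

theorem metric_dLeft (hm : IsBiinvariant m) (g : G) (X Y : GroupLieAlgebra 𝓘(ℝ, E) G) :
    m.inner g (dLeft E g X) (dLeft E g Y) = m.inner 1 X Y :=
  (metric_congr (mul_one g).symm _ _).trans (hm.1 g 1 X Y)

theorem metric_Ad (hm : IsBiinvariant m) (a : G) (X Y : GroupLieAlgebra 𝓘(ℝ, E) G) :
    m.inner 1 (Ad E a X) (Ad E a Y) = m.inner 1 X Y := by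
  have hAd : ∀ Z : GroupLieAlgebra 𝓘(ℝ, E) G, Ad E a Z =
      (mfderiv 𝓘(ℝ, E) 𝓘(ℝ, E) (fun x : G => x * a⁻¹) a : E →L[ℝ] E) (dLeft E a Z) := fun Z =>
    mfderiv_comp_apply_of_eq (E₁ := E) (E₂ := E) (E₃ := E)
    (k := fun y : G => y * a⁻¹) (f := fun x : G => a * x)
      (mul_one a) (mdifferentiable_mul_right _ _) (mdifferentiable_mul_left _ _) Z
  rw [hAd, hAd]
  exact ((metric_congr (mul_inv_cancel a).symm _ _).trans
    (hm.2 a⁻¹ a (dLeft E a X) (dLeft E a Y))).trans (metric_dLeft hm a X Y)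

end Metric

end Translations

/-! ### The isotropy representation on the biquotient -/

section Biquotient

open Manifold

variable {E : Type*} [NormedAddCommGroup E] [NormedSpace ℝ E]
  {G : Type*} [Group G] [TopologicalSpace G] [ChartedSpace E G] [LieGroup 𝓘(ℝ, E) ∞ G]
  (D : Setting G)
  {F : Type*} [NormedAddCommGroup F] [NormedSpace ℝ F] [ChartedSpace F D.Biquotient]

/-- If `Hg` is a fixed point, then in the coordinates `x ↦ π(gx)` the action of `t` on the
biquotient is conjugation by `ψ_g(t)`. -/
theorem smul_proj_mul {g : G} (hg : D.proj g ∈ MulAction.fixedPoints D.Tt D.Biquotient)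
    (t : D.Tt) (x : G) :
    t • D.proj (g * x) = D.proj (g * (D.psiG hg t * x * (D.psiG hg t)⁻¹)) := by
  rw [Setting.smul_proj]
  refine (Quotient.sound ⟨(D.psi hg t).1, (D.psi hg t).2, ?_⟩ : D.proj _ = D.proj _).symm
  rw [Setting.psiG_apply]
  have h := D.psi_spec hg t
  set s := D.psi hg t
  calc t.1.1 * (g * x) * t.1.2⁻¹ = (t.1.1 * g * t.1.2⁻¹) * (t.1.2 * x * t.1.2⁻¹) := by group
    _ = (s.1.1 * g * s.1.2⁻¹) * (t.1.2 * x * t.1.2⁻¹) := by rw [h]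
    _ = s.1.1 * (g * (s.1.2⁻¹ * t.1.2 * x * (s.1.2⁻¹ * t.1.2)⁻¹)) * s.1.2⁻¹ := by group

theorem mdifferentiableAt_smul (hπ : IsSubmersion 𝓘(ℝ, E) 𝓘(ℝ, F) ∞ D.proj) (t : D.Tt) (g : G) :
    MDifferentiableAt 𝓘(ℝ, F) 𝓘(ℝ, F) (fun b : D.Biquotient => t • b) (D.proj g) := by
  refine mdifferentiableAt_of_comp_submersion (hπ.isSubmersionAt g) ?_
  have hd : MDifferentiableAt 𝓘(ℝ, E) 𝓘(ℝ, F) D.proj (t.1.1 * g * t.1.2⁻¹) :=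
    (hπ.isSubmersionAt _).contMDiffAt.mdifferentiableAt (by simp)
  exact MDifferentiableAt.comp (f := fun x : G => t.1.1 * x * t.1.2⁻¹) g hd
    (mdifferentiable_mul_mul _ _ g)

theorem isotropy_dProj_dLeft (hπ : IsSubmersion 𝓘(ℝ, E) 𝓘(ℝ, F) ∞ D.proj) {g : G}
    (hg : D.proj g ∈ MulAction.fixedPoints D.Tt D.Biquotient) (t : D.Tt)
    (X : GroupLieAlgebra 𝓘(ℝ, E) G) :
    D.isotropy F (D.proj g) t (D.dProj E F g (dLeft E g X)) =
      D.dProj E F g (dLeft E g (Ad E (D.psiG hg t) X)) := by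
  have hd : MDifferentiableAt 𝓘(ℝ, E) 𝓘(ℝ, F) D.proj g :=
    (hπ.isSubmersionAt g).contMDiffAt.mdifferentiableAt (by simp)
  have hl : MDifferentiableAt 𝓘(ℝ, E) 𝓘(ℝ, E) (fun x : G => g * x) 1 :=
    mdifferentiable_mul_left g 1
  have hπl : MDifferentiableAt 𝓘(ℝ, E) 𝓘(ℝ, F) (fun x : G => D.proj (g * x)) 1 :=
    MDifferentiableAt.comp (1 : G) (by rwa [mul_one]) hl
  have hφ : ∀ Y : GroupLieAlgebra 𝓘(ℝ, E) G, D.dProj E F g (dLeft E g Y) =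
      (mfderiv 𝓘(ℝ, E) 𝓘(ℝ, F) (fun x : G => D.proj (g * x)) 1 : E →L[ℝ] F) Y := fun Y =>
    (mfderiv_comp_apply_of_eq (f := fun x : G => g * x) (mul_one g) hd hl Y).symm
  rw [hφ, hφ]
  have h1 := mfderiv_comp_apply_of_eq (k := fun b : D.Biquotient => t • b)
    (f := fun x : G => D.proj (g * x)) (congrArg D.proj (mul_one g))
    (mdifferentiableAt_smul D hπ t g) hπl X
  have h2 := mfderiv_comp_apply_of_eq (k := fun x : G => D.proj (g * x))
    (f := fun x : G => D.psiG hg t * x * (D.psiG hg t)⁻¹) (x := 1) (y := 1) (by simp) hπl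
    (mdifferentiable_mul_mul _ _ _) X
  have h3 := congrArg
    (fun f : G → D.Biquotient => (mfderiv 𝓘(ℝ, E) 𝓘(ℝ, F) f 1 : E →L[ℝ] F) X)
    (funext (smul_proj_mul D hg t))
  exact h1.symm.trans (h3.trans h2)

variable {m : Bundle.ContMDiffRiemannianMetric 𝓘(ℝ, E) ∞ E
  (fun x : G => TangentSpace 𝓘(ℝ, E) x)}

/-- By left invariance, `W_g` is the orthogonal complement of `ker (dπ_g ∘ d(l_g)_e)` in `𝔤`. -/
theorem mem_complement_iff (hm : IsBiinvariant m) {g : G} {Z : GroupLieAlgebra 𝓘(ℝ, E) G} :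
    Z ∈ D.complement F m g ↔
      ∀ X : GroupLieAlgebra 𝓘(ℝ, E) G, D.dProj E F g (dLeft E g X) = 0 → m.inner 1 X Z = 0 := by
  constructor
  · rintro ⟨w, hw, rfl⟩ X hX
    rw [← metric_dLeft hm g, dLeft_dLeftInv]
    exact hw _ hX
  · intro h
    refine ⟨dLeft E g Z, fun u hu => ?_, dLeftInv_dLeft g Z⟩
    rw [← dLeft_dLeftInv g u, metric_dLeft hm]
    exact h _ (by rwa [dLeft_dLeftInv])

theorem Ad_mem_complement (hπ : IsSubmersion 𝓘(ℝ, E) 𝓘(ℝ, F) ∞ D.proj) (hm : IsBiinvariant m)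
    {g : G} (hg : D.proj g ∈ MulAction.fixedPoints D.Tt D.Biquotient)
    {a : G} (ha : a ∈ (D.psiG hg).range) {Z : GroupLieAlgebra 𝓘(ℝ, E) G}
    (hZ : Z ∈ D.complement F m g) : Ad E a Z ∈ D.complement F m g := by
  rw [mem_complement_iff D hm] at hZ ⊢
  intro X hX
  obtain ⟨t, ht⟩ := (D.psiG hg).range.inv_mem ha
  rw [← Ad_inv_apply a X, metric_Ad hm]
  refine hZ _ ?_
  rw [← ht, ← isotropy_dProj_dLeft D hπ hg, hX, map_zero]

/-- In finite dimensions, a subspace and its orthogonal complement with respect to a Riemannian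
metric are complementary. -/
theorem isCompl_orthogonal [FiniteDimensional ℝ E] (K W : Submodule ℝ (GroupLieAlgebra 𝓘(ℝ, E) G))
    (hW : ∀ Z, Z ∈ W ↔ ∀ X ∈ K, m.inner 1 X Z = 0) : IsCompl W K := by
  have : FiniteDimensional ℝ (GroupLieAlgebra 𝓘(ℝ, E) G) := inferInstanceAs (FiniteDimensional ℝ E)
  let B : LinearMap.BilinForm ℝ (GroupLieAlgebra 𝓘(ℝ, E) G) :=
    LinearMap.mk₂ ℝ (fun X Y => m.inner 1 X Y) (fun _ _ _ => by simp) (fun _ _ _ => by simp)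
      (fun _ _ _ => by simp) (fun _ _ _ => by simp)
  have hB : B.IsRefl := fun X Y h => (m.symm 1 Y X).trans h
  have hWB : W = B.orthogonal K := Submodule.ext hW
  have hdis : Disjoint K (B.orthogonal K) := by
    rw [Submodule.disjoint_def]
    intro X hX hX'
    by_contra hne
    exact (m.pos 1 X hne).ne' (hX' X hX)
  rw [hWB]
  exact ((LinearMap.BilinForm.isCompl_orthogonal_iff_disjoint hB).mpr hdis).symm

end Biquotient

end BiquotientWeights

end

open BiquotientWeights in
theorem corollary3p8
    {E : Type*} [NormedAddCommGroup E] [NormedSpace ℝ E] [FiniteDimensional ℝ E]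
    {G : Type*} [Group G] [TopologicalSpace G] [IsTopologicalGroup G] [CompactSpace G]
    [ConnectedSpace G] [T2Space G] [ChartedSpace E G] [LieGroup 𝓘(ℝ, E) ∞ G]
    (D : Setting G)
    {F : Type*} [NormedAddCommGroup F] [NormedSpace ℝ F] [FiniteDimensional ℝ F]
    [ChartedSpace F D.Biquotient] [IsManifold 𝓘(ℝ, F) ∞ D.Biquotient]
    (hπ : Manifold.IsSubmersion 𝓘(ℝ, E) 𝓘(ℝ, F) ∞ D.proj)
    (m : Bundle.ContMDiffRiemannianMetric 𝓘(ℝ, E) ∞ E (fun x : G => TangentSpace 𝓘(ℝ, E) x))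
    (hm : IsBiinvariant m)
    (g : G) (hg : D.proj g ∈ MulAction.fixedPoints D.Tt D.Biquotient) :
    (∀ (t : D.Tt) (X : GroupLieAlgebra 𝓘(ℝ, E) G),
      D.isotropy F (D.proj g) t (D.dProj E F g (dLeft E g X)) =
        D.dProj E F g (dLeft E g (Ad E (D.psiG hg t) X))) ∧
    (∀ a ∈ (D.psiG hg).range, ∀ X ∈ D.complement F m g, Ad E a X ∈ D.complement F m g) ∧
    weights (D.isotropy F (D.proj g)) ⊤ =
      {μ | ∃ l ∈ weights (fun a : (D.psiG hg).range => Ad E (a : G)) (D.complement F m g),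
        μ = l ∘ₗ OneParam.differential (D.psiIm hg)} := by
  have hequiv := isotropy_dProj_dLeft D hπ hg
  have hinv : ∀ a ∈ (D.psiG hg).range, ∀ X ∈ D.complement F m g, Ad E a X ∈ D.complement F m g :=
    fun a ha X hX => Ad_mem_complement D hπ hm hg ha hX
  refine ⟨hequiv, hinv, ?_⟩
  obtain ⟨k, ⟨e⟩⟩ := D.Tt_torus
  have hsurj : Function.Surjective (D.dProj E F g ∘ₗ dLeft E g) := fun u => by
    obtain ⟨v, hv⟩ := mfderiv_surjective_of_isSubmersionAt (hπ.isSubmersionAt g) u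
    exact ⟨dLeftInv E g v, (congrArg (D.dProj E F g) (dLeft_dLeftInv g v)).trans hv⟩
  have hcompl : IsCompl (D.complement F m g) (LinearMap.ker (D.dProj E F g ∘ₗ dLeft E g)) :=
    isCompl_orthogonal (m := m) _ _ fun Z => mem_complement_iff D hm
  rw [weights_top_eq_of_isCompl (fun t : D.Tt => Ad E (D.psiG hg t)) _ _ hsurj hequiv _ hcompl
    fun t X hX => hinv _ ⟨t, rfl⟩ X hX]
  exact weights_comp_surjective e (D.psiIm hg) (D.psiG hg).rangeRestrict_surjective
    ((AdHom E).comp (D.psiG hg).range.subtype) (D.complement F m g)
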